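/- Let $q$ be a prime power, $\mathbb F=\mathbb F_q$ and $n=q-1$. Definitions. A convolutional code $\mathcal C\subseteq\mathbb F[z]^n$ with parameters $(n,k,\delta)_q$ is a submodule $\mathcal C=\operatorname{im}G=\{uG\mid u\in\mathbb F[z]^k\}$, where $G\in\mathbb F[z]^{k\times n}$ is a right-invertible matrix and $\delta$ is the maximum degree of the $k\times k$ minors of $G$. A matrix $G\in\mathbb F[z]^{k\times n}$ of rank $k$ is called minimal if the maximum degree of its $k\times k$ minors equals the sum of its row degrees, where the degree of a row is the maximum degree of its entries. The memory of $\mathcal C$ is the largest row degree of a minimal matrix $G$ with $\mathcal C=\operatorname{im}G$ (it does not depend on the choice of $G$). The weight of $v=\sum_{j=0}^N v_jz^j\in\mathbb F[z]^n$, $v_j\in\mathbb F^n$, is $\operatorname{wt}(v)=\sum_{j=0}^N\operatorname{wt}(v_j)$, where $\operatorname{wt}(v_j)$ is the Hamming weight, and $\operatorname{dist}(\mathcal C)=\min\{\operatorname{wt}(v)\mid v\in\mathcal C,\ v\neq0\}$. Proposition. Let $k>1$ and let $\mathcal C\subseteq\mathbb F[z]^n$ be a convolutional code with parameters $(n,k,km)_q$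 and memory $m$, where $m\le\frac nk-1$. Then $$\operatorname{dist}(\mathcal C)\le(m+1)(n-k+1)+(k-2)m.$$ -/

import Mathlib

open Polynomial

namespace ConvCode

variable {F : Type*} [Field F] {k n : ℕ}

/-- The degree of a polynomial vector: the maximum degree of its components
(with the value `0` for the zero vector). -/
def vecDegree (v : Fin n → F[X]) : ℕ :=
  Finset.univ.sup fun i => (v i).natDegree

/-- The `k`-minor of `G ∈ F[z]^{k × n}` on the columns selected by `s`. -/
noncomputable def minor (G : Matrix (Fin k) (Fin n) F[X]) (s : Fin k ↪o Fin n) : F[X] :=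
  (G.submatrix id s).det

open scoped Classical in
/-- The maximum degree of the `k`-minors of `G`. -/
noncomputable def minorDegree (G : Matrix (Fin k) (Fin n) F[X]) : ℕ :=
  Finset.univ.sup fun s : Fin k ↪o Fin n => (minor G s).natDegree

/-- The submodule `im G = {u G | u ∈ F[z]^k}` of `F[z]^n`. -/
noncomputable def im (G : Matrix (Fin k) (Fin n) F[X]) : Submodule F[X] (Fin n → F[X]) :=
  LinearMap.range G.vecMulLinear

/-- `C ⊆ F[z]^n` is a convolutional code with parameters `(n, k, δ)`. -/
def IsConvolutionalCode (C : Submodule F[X] (Fin n → F[X])) (k δ : ℕ) : Prop :=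
  ∃ G : Matrix (Fin k) (Fin n) F[X],
    (∃ H : Matrix (Fin n) (Fin k) F[X], G * H = 1) ∧ C = im G ∧ δ = minorDegree G

/-- `G ∈ F[z]^{k × n}` is minimal: it has rank `k`, and the maximum degree of its `k`-minors is
the sum of its row degrees. -/
def IsMinimal (G : Matrix (Fin k) (Fin n) F[X]) : Prop :=
  LinearIndependent F[X] G.row ∧ minorDegree G = ∑ i, vecDegree (G i)

/-- The submodule `S` has memory `m`: the largest row degree of a minimal generator matrix of `S`
is `m`. (The row degrees of a minimal generator matrix are determined by `S` up to order.) -/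
def HasMemory (S : Submodule F[X] (Fin n → F[X])) (m : ℕ) : Prop :=
  ∃ (k : ℕ) (G : Matrix (Fin k) (Fin n) F[X]),
    IsMinimal G ∧ S = im G ∧ m = Finset.univ.sup fun i => vecDegree (G i)

/-- The weight of `v = ∑ v_j z^j`: the sum of the Hamming weights of the coefficients
`v_j ∈ F^n`. -/
def wt [DecidableEq F] (v : Fin n → F[X]) : ℕ :=
  ∑ j ∈ Finset.range (vecDegree v + 1), hammingNorm fun i => (v i).coeff j

/-- The free distance: the minimum weight of a nonzero element of `C`. -/
noncomputable def dist [DecidableEq F] (C : Submodule F[X] (Fin n → F[X])) : ℕ :=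
  sInf {w | ∃ v ∈ C, v ≠ 0 ∧ wt v = w}

end ConvCode

namespace ConvCode

open Finset

/-! Constant messages give a `k`-dimensional `F`-linear block code of length `(m+1)n`, since every
row degree is at most `m`. Words vanishing at `k-2` chosen positions form a space of dimension at
least 2, hence contain a pencil of `q+1` nonzero words. At each remaining position some member
vanishes, so the average weight, and thus the distance, is at most `q/(q+1) * ((m+1)n - (k-2))`.
With `q = n+1` and `k(m+1) ≤ n`, integrality yields the claim. -/

/-- The members of the pencil spanned by `a` and `b`: the vectors `a + t • b`, and `b` itself. -/
def pencil {K V : Type*} [Field K] [AddCommGroup V] [Module K V] (a b : V) : Option K → V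
  | none => b
  | some t => a + t • b

theorem pencil_ne_zero {K V : Type*} [Field K] [AddCommGroup V] [Module K V] {a b : V}
    (h : LinearIndependent K ![a, b]) (t : Option K) : pencil a b t ≠ 0 := by
  rw [LinearIndependent.pair_iff] at h
  intro h0
  cases t with
  | none => simpa using h 0 1 (by simpa [pencil] using h0)
  | some t => simpa using h 1 t (by simpa [pencil] using h0)

/-- A functional on a plane has a kernel, so it vanishes at some point of the projective line;
`none` is the point at infinity. -/
theorem exists_pencil_eq_zero {K V : Type*} [Field K] [AddCommGroup V] [Module K V]
    (f : V →ₗ[K] K) (a b : V) : ∃ t : Option K, f (pencil a b t) = 0 := by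
  by_cases hb : f b = 0
  · exact ⟨none, hb⟩
  · refine ⟨some (-(f a / f b)), ?_⟩
    simp [pencil, hb]

/-- Fix `r` coordinates; a linear code of dimension at least `r + 2` contains a nonzero word that
vanishes there and satisfies the Plotkin bound on the remaining coordinates. -/
theorem exists_ne_zero_hammingNorm_le {K V ι : Type*} [Field K] [Fintype K] [DecidableEq K]
    [AddCommGroup V] [Module K V] [FiniteDimensional K V] [Fintype ι]
    (φ : V →ₗ[K] ι → K) (r : ℕ) (hr : r + 2 ≤ Module.finrank K V) (hι : r ≤ Fintype.card ι) :
    ∃ v ≠ 0, (Fintype.card K + 1) * hammingNorm (φ v) ≤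
      Fintype.card K * (Fintype.card ι - r) := by
  classical
  obtain ⟨S, -, hS⟩ := Finset.exists_subset_card_eq (s := (Finset.univ : Finset ι)) (n := r)
    (by simpa using hι)
  let ψ : V →ₗ[K] S → K := LinearMap.pi fun s => LinearMap.proj (s : ι) ∘ₗ φ
  have hker : 1 < Module.finrank K (LinearMap.ker ψ) := by
    have h1 := ψ.finrank_range_add_finrank_ker
    have h2 := (LinearMap.range ψ).finrank_le
    rw [Module.finrank_fintype_fun_eq_card, Fintype.card_coe, hS] at h2
    omega
  obtain ⟨w, hw⟩ : ∃ w : Fin 2 → LinearMap.ker ψ, LinearIndependent K w :=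
    exists_linearIndependent_of_le_finrank hker
  have hw' : LinearIndependent K ![(w 0 : V), (w 1 : V)] := by
    have := hw.map' (LinearMap.ker ψ).subtype (Submodule.ker_subtype _)
    have he : ![(w 0 : V), (w 1 : V)] = (LinearMap.ker ψ).subtype ∘ w := by
      ext i
      fin_cases i <;> rfl
    rwa [he]
  set p : Option K → V := pencil (w 0 : V) (w 1 : V) with hp
  have hmem : ∀ t, p t ∈ LinearMap.ker ψ := by
    rintro (_ | t)
    · exact (w 1).2
    · exact add_mem (w 0).2 (Submodule.smul_mem _ _ (w 1).2)
  have hzero : ∀ t, ∀ c ∈ S, φ (p t) c = 0 := fun t c hc =>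
    congrFun (LinearMap.mem_ker.1 (hmem t)) ⟨c, hc⟩
  have hcol : ∀ c, #{t | φ (p t) c ≠ 0} ≤ Fintype.card K := by
    intro c
    obtain ⟨t, ht⟩ := exists_pencil_eq_zero (LinearMap.proj c ∘ₗ φ) (w 0 : V) (w 1 : V)
    have h1 : #{t | φ (p t) c ≠ 0} < Fintype.card (Option K) :=
      Finset.card_lt_univ_of_notMem (x := t) (by simpa using ht)
    rw [Fintype.card_option] at h1
    omega
  have hsum : ∑ t, hammingNorm (φ (p t)) ≤ Fintype.card K * (Fintype.card ι - r) := by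
    have h1 : ∀ t, hammingNorm (φ (p t)) = #{c ∈ Sᶜ | φ (p t) c ≠ 0} := by
      intro t
      rw [hammingNorm]
      congr 1
      ext c
      have := hzero t c
      simp only [mem_filter, mem_univ, true_and, mem_compl]
      tauto
    simp_rw [h1]
    -- Double counting of the nonzero entries, by words and by positions.
    calc ∑ t, #{c ∈ Sᶜ | φ (p t) c ≠ 0} = ∑ c ∈ Sᶜ, #{t | φ (p t) c ≠ 0} :=
          Finset.sum_card_bipartiteAbove_eq_sum_card_bipartiteBelow _
      _ ≤ #Sᶜ * Fintype.card K := Finset.sum_le_card_nsmul _ _ _ fun c _ => hcol c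
      _ = _ := by rw [Finset.card_compl, hS, mul_comm]
  obtain ⟨t, -, ht⟩ := Finset.exists_min_image (Finset.univ : Finset (Option K))
    (fun t => hammingNorm (φ (p t))) Finset.univ_nonempty
  refine ⟨p t, pencil_ne_zero hw' t, le_trans ?_ hsum⟩
  have := Finset.card_nsmul_le_sum Finset.univ (fun t => hammingNorm (φ (p t))) _ ht
  simpa [Fintype.card_option] using this

variable {F : Type*} [Field F] {k n : ℕ}

theorem finrank_im {G : Matrix (Fin k) (Fin n) F[X]} (h : LinearIndependent F[X] G.row) :
    Module.finrank F[X] (im G) = k :=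
  (LinearMap.finrank_range_of_inj (f := G.vecMulLinear)
    (Matrix.vecMul_injective_iff.2 h)).trans (Module.finrank_fin_fun F[X])

theorem linearIndependent_row_of_mul_eq_one {G : Matrix (Fin k) (Fin n) F[X]}
    {H : Matrix (Fin n) (Fin k) F[X]} (h : G * H = 1) : LinearIndependent F[X] G.row := by
  rw [← Matrix.vecMul_injective_iff]
  intro u v huv
  have := congrArg (fun x => Matrix.vecMul x H) huv
  simpa [Matrix.vecMul_vecMul, h] using this

theorem natDegree_le_vecDegree (v : Fin n → F[X]) (i : Fin n) : (v i).natDegree ≤ vecDegree v :=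
  Finset.le_sup (f := fun i => (v i).natDegree) (Finset.mem_univ i)

/-- The word `u G` of a constant message `u`, as the tuple of its first `m + 1` coefficients. -/
noncomputable def constWord (G : Matrix (Fin k) (Fin n) F[X]) (m : ℕ) :
    (Fin k → F) →ₗ[F] Fin (m + 1) × Fin n → F where
  toFun u c := (Matrix.vecMul (fun r => C (u r)) G c.2).coeff c.1
  map_add' u v := by
    ext c
    simp [Matrix.vecMul, dotProduct, add_mul, Finset.sum_add_distrib]
  map_smul' a u := by
    ext c
    simp [Matrix.vecMul, dotProduct, Finset.mul_sum, mul_assoc]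

theorem wt_le_hammingNorm [DecidableEq F] {v : Fin n → F[X]} {m : ℕ} (hv : vecDegree v ≤ m) :
    wt v ≤ hammingNorm fun c : Fin (m + 1) × Fin n => (v c.2).coeff c.1 := by
  calc wt v ≤ ∑ j ∈ Finset.range (m + 1), hammingNorm fun i => (v i).coeff j :=
        Finset.sum_le_sum_of_subset (Finset.range_mono (by omega))
    _ = _ := by
      rw [Finset.sum_range]
      simp only [hammingNorm, Finset.card_filter, Fintype.sum_prod_type]

theorem vecDegree_vecMul_C_le {G : Matrix (Fin k) (Fin n) F[X]} {m : ℕ}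
    (hG : ∀ r, vecDegree (G r) ≤ m) (u : Fin k → F) :
    vecDegree (Matrix.vecMul (fun r => C (u r)) G) ≤ m := by
  refine Finset.sup_le fun i _ => ?_
  rw [Matrix.vecMul, dotProduct]
  refine natDegree_sum_le_of_forall_le _ _ fun r _ => ?_
  exact (natDegree_C_mul_le _ _).trans ((natDegree_le_vecDegree (G r) i).trans (hG r))

theorem dist_le_wt [DecidableEq F] {S : Submodule F[X] (Fin n → F[X])} {v : Fin n → F[X]}
    (hv : v ∈ S) (h0 : v ≠ 0) : dist S ≤ wt v :=
  Nat.sInf_le ⟨v, hv, h0, rfl⟩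

/-- A Plotkin-type bound on the free distance of a code all of whose row degrees are at most `m`,
obtained from its codewords of degree at most `m`. -/
theorem card_add_one_mul_dist_le [Fintype F] [DecidableEq F] {G : Matrix (Fin k) (Fin n) F[X]}
    {m r : ℕ} (hG : LinearIndependent F[X] G.row) (hdeg : ∀ i, vecDegree (G i) ≤ m)
    (hr : r + 2 ≤ k) (hN : r ≤ (m + 1) * n) :
    (Fintype.card F + 1) * dist (im G) ≤ Fintype.card F * ((m + 1) * n - r) := by
  obtain ⟨u, hu, hle⟩ := exists_ne_zero_hammingNorm_le (constWord G m) r (by simpa using hr)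
    (by simpa using hN)
  have h0 : Matrix.vecMul (fun i => C (u i)) G ≠ 0 := by
    intro h
    have := Matrix.vecMul_injective_iff.2 hG (h.trans (Matrix.zero_vecMul G).symm)
    exact hu (funext fun i => by simpa using congrFun this i)
  have hd := (dist_le_wt (S := im G) ⟨fun i => C (u i), rfl⟩ h0).trans
    (wt_le_hammingNorm (vecDegree_vecMul_C_le hdeg u))
  refine (Nat.mul_le_mul_left _ hd).trans ?_
  simpa [constWord] using hle

end ConvCode

theorem proposition4p1 {F : Type*} [Field F] [Fintype F] [DecidableEq F] (q n k m : ℕ)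
    (hq : Fintype.card F = q) (hn : n = q - 1) (hk : 1 < k)
    (C : Submodule (Polynomial F) (Fin n → Polynomial F))
    (hC : ConvCode.IsConvolutionalCode C k (k * m)) (hmem : ConvCode.HasMemory C m)
    (hm : (m : ℚ) ≤ (n : ℚ) / (k : ℚ) - 1) :
    (ConvCode.dist C : ℤ) ≤ ((m : ℤ) + 1) * ((n : ℤ) - k + 1) + ((k : ℤ) - 2) * m := by
  obtain ⟨G₀, ⟨H, hH⟩, hG₀, -⟩ := hC
  obtain ⟨l, G, ⟨hG, -⟩, rfl, hsup⟩ := hmem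
  -- Both generator matrices have independent rows, so each row count is the rank of the same
  -- module.
  obtain rfl : l = k := by
    rw [← ConvCode.finrank_im hG, hG₀,
      ConvCode.finrank_im (ConvCode.linearIndependent_row_of_mul_eq_one hH)]
  have hdeg : ∀ i, ConvCode.vecDegree (G i) ≤ m := fun i =>
    hsup ▸ Finset.le_sup (f := fun i => ConvCode.vecDegree (G i)) (Finset.mem_univ i)
  have hlen : l * (m + 1) ≤ n := by
    have hl : (0 : ℚ) < l := by exact_mod_cast (by omega : 0 < l)
    have h1 : ((m : ℚ) + 1) ≤ n / l := by linarith
    rw [le_div_iff₀ hl] at h1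
    rw [mul_comm]
    exact_mod_cast h1
  have hq1 : q = n + 1 := by
    have : 0 < q := hq ▸ Fintype.card_pos
    omega
  have hln : l ≤ n := le_trans (Nat.le_mul_of_pos_right l m.succ_pos) hlen
  have hN : l - 2 ≤ (m + 1) * n :=
    (Nat.sub_le _ _).trans (hln.trans (Nat.le_mul_of_pos_left n m.succ_pos))
  -- `l - 2` is the largest number of imposed zeros that still guarantees a pencil.
  have hmain := ConvCode.card_add_one_mul_dist_le hG hdeg (r := l - 2) (by omega) hN
  rw [hq, hq1] at hmain
  zify [hN, hk] at hmain hlen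
  have hk' : (2 : ℤ) ≤ l := by exact_mod_cast hk
  rw [Nat.cast_sub (by omega)] at hmain
  push_cast at hmain
  -- The target equals `N - m - 1` with `N = (m+1)n - l + 2`. A distance of at least `N - m` would
  -- force `N ≤ (n+2)m`, that is `n + 2 ≤ 2m + l`, against `2m + l ≤ l(m+1) ≤ n`.
  by_contra! hcon
  have h2 : 2 * (m : ℤ) + l ≤ n := by nlinarith
  nlinarith
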